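/- Let $M$ be a compact complex manifold and $L$ a holomorphic line bundle on $M$; write $iL=L^{\otimes i}$. For $i\ge 1$ let $\mathrm{Bs}|iL|\subseteq M$ be the set of common zeros of all sections in $H^0(M,iL)$, and let $$\varphi_{|iL|}\colon M\setminus \mathrm{Bs}|iL|\longrightarrow \mathbb{P}\bigl(H^0(M,iL)^*\bigr)$$ be the map sending $x$ to the class of the evaluation $s\mapsto s(x)$. We say that $\varphi_{|iL|}$ is an embedding of a subset $U\subseteq M$ (in what follows $U=M$ or $U$ open) if $U\cap \mathrm{Bs}|iL|=\emptyset$, $\varphi_{|iL|}$ restricts to a homeomorphism of $U$ onto its image, and the differential of $\varphi_{|iL|}$ is injective at every point of $U$. Assume that $(M,L)$ is a polarized manifold, i.e. that $L$ is ample: for some $k\ge 1$ the bundle $kL$ is very ample, meaning that $\varphi_{|kL|}$ is an embedding of $M$. Suppose that $L$ is effective, i.e. $H^0(M,L)\neq 0$, and, for some integer $r\ge 1$, $r$-generated, i.e. the graded algebra $G(M,L)=\bigoplus_{i\ge 1}H^0(M,iL)$ is generated by the sections in $H^0(M,L),\dots,H^0(M,rL)$. Then $\varphi_{|rL|}$ is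 an embedding of $M\setminus \mathrm{Bs}|L|$. In particular, the sections of $rL$ separate points and tangent vectors there: for all $p\neq q$ in $M\setminus \mathrm{Bs}|L|$ there is $s\in H^0(M,rL)$ with $s(p)=0$ and $s(q)\neq 0$, and for every $p\in M\setminus \mathrm{Bs}|L|$ and every nonzero $\tau\in T_pM$ there is $s\in H^0(M,rL)$ with $s(p)=0$ and $ds_p(\tau)\neq 0$. -/

import Mathlib

open Bundle Manifold Topology
open scoped ContDiff LinearAlgebra.Projectivization

noncomputable section

namespace PolarizedManifold

/-- The topology of the projective space `ℙ(V^*)`: the quotient topology of `V^* \ {0}`, where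
`V^*` carries pointwise convergence on `V` (for finite-dimensional `V` this is the usual topology
of `V^*`, and `ℙ(V^*)` is the usual projective space). -/
instance instTopologicalSpaceProj (V : Type*) [AddCommGroup V] [Module ℂ V] :
    TopologicalSpace (ℙ ℂ (Module.Dual ℂ V)) :=
  TopologicalSpace.coinduced
    (fun v : {v : Module.Dual ℂ V // v ≠ 0} => Projectivization.mk ℂ v.1 v.2)
    (TopologicalSpace.induced (fun v (s : V) => v.1 s) inferInstance)

section Bundle

variable (E : Type*) [NormedAddCommGroup E] [NormedSpace ℂ E]
  {M : Type*} [TopologicalSpace M] [ChartedSpace E M]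
  (L : M → Type*) [TopologicalSpace (TotalSpace ℂ L)]
  [∀ x, AddCommGroup (L x)] [∀ x, Module ℂ (L x)] [∀ x, TopologicalSpace (L x)]
  [FiberBundle ℂ L] [VectorBundle ℂ ℂ L]

section Coord

variable {L}

/-- The coordinate, in the local trivialization `e` of `L`, of a family `s` of tensors on the
fibres of `L`. A trivialization `e_x : L_x ≃ ℂ` extends to the tensor algebra of `L_x`; on the
homogeneous part `L_x^{⊗ i}` the extension is the trivialization `e_x^{⊗ i} : L_x^{⊗ i} ≃ ℂ`. -/
def coord (e : Trivialization ℂ (π ℂ L)) [MemTrivializationAtlas e]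
    (s : ∀ x, TensorAlgebra ℂ (L x)) (x : M) : ℂ :=
  TensorAlgebra.lift ℂ (e.linearMapAt ℂ x) (s x)

variable (e : Trivialization ℂ (π ℂ L)) [MemTrivializationAtlas e]

theorem coord_zero : coord e (0 : ∀ x, TensorAlgebra ℂ (L x)) = 0 := by
  funext x; simp [coord]

theorem coord_add (s t : ∀ x, TensorAlgebra ℂ (L x)) :
    coord e (s + t) = coord e s + coord e t := by
  funext x; simp [coord]

theorem coord_smul (c : ℂ) (s : ∀ x, TensorAlgebra ℂ (L x)) :
    coord e (c • s) = c • coord e s := by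
  funext x; simp [coord]

theorem coord_mul (s t : ∀ x, TensorAlgebra ℂ (L x)) :
    coord e (s * t) = coord e s * coord e t := by
  funext x; simp [coord]

theorem eq_zero_of_coord_eq_zero {i : ℕ} {s : ∀ x, TensorAlgebra ℂ (L x)} {x : M}
    (hx : x ∈ e.baseSet) (hs : s x ∈ LinearMap.range (TensorAlgebra.ι ℂ (M := L x)) ^ i)
    (h : coord e s x = 0) : s x = 0 := by
  set ℓ : L x ≃ₗ[ℂ] ℂ := e.linearEquivAt ℂ x hx with hℓ
  have hle : e.linearMapAt ℂ x = (ℓ : L x →ₗ[ℂ] ℂ) := e.linearMapAt_def_of_mem hx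
  have hr : LinearMap.range (TensorAlgebra.ι ℂ (M := L x)) =
      Submodule.span ℂ {TensorAlgebra.ι ℂ (ℓ.symm 1)} := by
    apply le_antisymm
    · rintro _ ⟨v, rfl⟩
      refine Submodule.mem_span_singleton.2 ⟨ℓ v, ?_⟩
      rw [← map_smul, ← map_smul, smul_eq_mul, mul_one, ℓ.symm_apply_apply]
    · rw [Submodule.span_singleton_le_iff_mem]
      exact ⟨_, rfl⟩
  rw [hr, Submodule.span_pow, Set.singleton_pow, Submodule.mem_span_singleton] at hs
  obtain ⟨c, hc⟩ := hs
  have : c = 0 := by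
    rw [coord, ← hc, hle] at h
    simpa using h
  rw [← hc, this, zero_smul]

end Coord

/-- `H⁰(M, iL)`: the holomorphic sections of `L^{⊗ i}`, as a subspace of the families of elements
of the tensor algebras of the fibres. The value of a section at `x` lies in the degree `i` part
`L_x^{⊗ i}` of the tensor algebra, and its coordinate is holomorphic in every local trivialization
of `L`. -/
def H0 (i : ℕ) : Submodule ℂ (∀ x, TensorAlgebra ℂ (L x)) where
  carrier := {s | (∀ x, s x ∈ LinearMap.range (TensorAlgebra.ι ℂ (M := L x)) ^ i) ∧
    ∀ (e : Trivialization ℂ (π ℂ L)) [MemTrivializationAtlas e],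
      ContMDiffOn 𝓘(ℂ, E) 𝓘(ℂ, ℂ) ω (coord e s) e.baseSet}
  add_mem' := by
    rintro s t ⟨hs, hs'⟩ ⟨ht, ht'⟩
    refine ⟨fun x => Submodule.add_mem _ (hs x) (ht x), fun e _ => ?_⟩
    rw [coord_add]
    exact (hs' e).add (ht' e)
  zero_mem' := by
    refine ⟨fun x => Submodule.zero_mem _, fun e _ => ?_⟩
    rw [coord_zero]
    exact contMDiffOn_const
  smul_mem' := by
    rintro c s ⟨hs, hs'⟩
    refine ⟨fun x => Submodule.smul_mem _ c (hs x), fun e _ => ?_⟩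
    rw [coord_smul]
    have hc : ContMDiffOn 𝓘(ℂ, E) 𝓘(ℂ, ℂ) ω (fun _ : M => c) e.baseSet := contMDiffOn_const
    exact hc.smul (hs' e)

theorem mul_mem_H0 {i j : ℕ} {s t : ∀ x, TensorAlgebra ℂ (L x)}
    (hs : s ∈ H0 E L i) (ht : t ∈ H0 E L j) : s * t ∈ H0 E L (i + j) := by
  refine ⟨fun x => ?_, fun e _ => ?_⟩
  · rw [pow_add]
    exact Submodule.mul_mem_mul (hs.1 x) (ht.1 x)
  · rw [coord_mul]
    exact (hs.2 e).mul (ht.2 e)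

/-- The graded algebra `G(M, L) = ⨁_{i ≥ 1} H⁰(M, iL)` (without unit), realized as the sum of the
spaces `H⁰(M, iL)`, `i ≥ 1`, inside the families of elements of the tensor algebras of the fibres;
the product is the tensor product of sections. -/
def sectionAlgebra : NonUnitalSubalgebra ℂ (∀ x, TensorAlgebra ℂ (L x)) :=
  { (⨆ i : {i : ℕ // 1 ≤ i}, H0 E L i) with
    mul_mem' := by
      intro a b ha hb
      have h : (⨆ i : {i : ℕ // 1 ≤ i}, H0 E L i) * (⨆ i : {i : ℕ // 1 ≤ i}, H0 E L i) ≤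
          ⨆ i : {i : ℕ // 1 ≤ i}, H0 E L i := by
        rw [Submodule.iSup_mul]
        refine iSup_le fun i => ?_
        rw [Submodule.mul_iSup]
        refine iSup_le fun j => Submodule.mul_le.2 fun s hs t ht => ?_
        exact Submodule.mem_iSup_of_mem (⟨i + j, le_add_right i.2⟩ : {i : ℕ // 1 ≤ i})
          (mul_mem_H0 E L hs ht)
      exact h (Submodule.mul_mem_mul ha hb) }

/-- `L` is `r`-generated: the sections of `L, 2L, …, rL` generate the algebra `G(M, L)`. -/
def IsGenerated (r : ℕ) : Prop :=
  NonUnitalAlgebra.adjoin ℂ (⋃ i ∈ Set.Icc 1 r, (H0 E L i : Set (∀ x, TensorAlgebra ℂ (L x)))) =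
    sectionAlgebra E L

/-- `L` is effective: it has a nonzero holomorphic section. -/
def IsEffective : Prop := ∃ s ∈ H0 E L 1, s ≠ 0

/-- The base locus `Bs |iL|`: the common zeros of all sections of `iL`. -/
def baseLocus (i : ℕ) : Set M := {x | ∀ s ∈ H0 E L i, s x = 0}

/-- Evaluation at `x` of the sections of `iL`, read in the trivialization of `L` at `x`. -/
def evalAt (i : ℕ) (x : M) : Module.Dual ℂ (H0 E L i) where
  toFun s := coord (trivializationAt ℂ L x) s.1 x
  map_add' s t := by simp [coord_add]
  map_smul' c s := by simp [coord_smul]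

theorem evalAt_ne_zero {i : ℕ} {x : M} (hx : x ∉ baseLocus E L i) : evalAt E L i x ≠ 0 := by
  intro h
  refine hx fun s hs => ?_
  exact eq_zero_of_coord_eq_zero (trivializationAt ℂ L x)
    (FiberBundle.mem_baseSet_trivializationAt' x) (hs.1 x)
    (LinearMap.congr_fun h (⟨s, hs⟩ : H0 E L i))

/-- The map `φ_{|iL|} : M \ Bs |iL| → ℙ(H⁰(M, iL)^*)`, sending `x` to the class of the
evaluation at `x`. Another choice of trivialization of `L` at `x` rescales the evaluation and so
gives the same point. -/
def phi (i : ℕ) (x : {x : M // x ∉ baseLocus E L i}) : ℙ ℂ (Module.Dual ℂ (H0 E L i)) :=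
  Projectivization.mk ℂ (evalAt E L i x.1) (evalAt_ne_zero E L x.2)

variable {E L} in
theorem mdifferentiableAt_coord {i : ℕ} (s : H0 E L i) (x : M) :
    MDifferentiableAt 𝓘(ℂ, E) 𝓘(ℂ, ℂ) (coord (trivializationAt ℂ L x) s.1) x :=
  ((s.2.2 (trivializationAt ℂ L x)).contMDiffAt
    ((trivializationAt ℂ L x).open_baseSet.mem_nhds
      (FiberBundle.mem_baseSet_trivializationAt' x))).mdifferentiableAt (by simp)

/-- The derivative `ds(τ)` at `x` of a section `s` of `iL` along a tangent vector `τ`, computed in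
the trivialization of `L` at `x`. If `s x = 0`, it does not depend on the trivialization up to a
nonzero factor. -/
def dSection (i : ℕ) (x : M) (τ : TangentSpace 𝓘(ℂ, E) x) (s : H0 E L i) : ℂ :=
  mfderiv 𝓘(ℂ, E) 𝓘(ℂ, ℂ) (coord (trivializationAt ℂ L x) s.1) x τ

variable {E} in
theorem mfderiv_apply_congr {f g : M → ℂ} (h : f = g) (x : M) (τ : TangentSpace 𝓘(ℂ, E) x) :
    (mfderiv 𝓘(ℂ, E) 𝓘(ℂ, ℂ) f x τ : ℂ) = (mfderiv 𝓘(ℂ, E) 𝓘(ℂ, ℂ) g x τ : ℂ) := by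
  subst h
  rfl

/-- The derivative at `x` of the local lift `y ↦ (s ↦ s(y))` of `φ_{|iL|}` to `H⁰(M, iL)^*`, all
sections being read in the trivialization of `L` at `x`. -/
def dEvalAt (i : ℕ) (x : M) :
    TangentSpace 𝓘(ℂ, E) x →ₗ[ℂ] Module.Dual ℂ (H0 E L i) where
  toFun τ :=
    { toFun := dSection E L i x τ
      map_add' := fun s t => by
        have h := mfderiv_add (mdifferentiableAt_coord s x) (mdifferentiableAt_coord t x)
        exact (mfderiv_apply_congr (coord_add _ s.1 t.1) x τ).trans (congrArg (fun f => f τ) h)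
      map_smul' := fun c s => by
        have h := const_smul_mfderiv (mdifferentiableAt_coord s x) c
        exact (mfderiv_apply_congr (coord_smul _ c s.1) x τ).trans (congrArg (fun f => f τ) h) }
  map_add' τ σ := by
    ext s
    exact (mfderiv 𝓘(ℂ, E) 𝓘(ℂ, ℂ) (coord (trivializationAt ℂ L x) s.1) x).map_add τ σ
  map_smul' c τ := by
    ext s
    exact (mfderiv 𝓘(ℂ, E) 𝓘(ℂ, ℂ) (coord (trivializationAt ℂ L x) s.1) x).map_smul c τ

/-- The differential of `φ_{|iL|}` at `x`, with values in the tangent space of `ℙ(W)` at `[v]`,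
which is `W / ℂ v`; here `W = H⁰(M, iL)^*` and `v` is the evaluation at `x`. -/
def dPhi (i : ℕ) (x : M) :
    TangentSpace 𝓘(ℂ, E) x →ₗ[ℂ]
      (Module.Dual ℂ (H0 E L i) ⧸ Submodule.span ℂ {evalAt E L i x}) :=
  (Submodule.span ℂ {evalAt E L i x}).mkQ ∘ₗ dEvalAt E L i x

/-- `φ_{|iL|}` is an embedding of `U`: it is defined at all points of `U`, it is a homeomorphism
of `U` onto its image, and its differential is injective at each point of `U`. -/
def IsEmbeddingOn (i : ℕ) (U : Set M) : Prop :=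
  ∃ hU : ∀ x ∈ U, x ∉ baseLocus E L i,
    IsEmbedding (fun x : U => phi E L i ⟨x.1, hU x.1 x.2⟩) ∧
    ∀ x ∈ U, Function.Injective (dPhi E L i x)

/-- `iL` is very ample: `φ_{|iL|}` is an embedding of the whole of `M`. -/
def IsVeryAmple (i : ℕ) : Prop := IsEmbeddingOn E L i Set.univ

/-- `L` is ample: some positive multiple of `L` is very ample. -/
def IsAmple : Prop := ∃ k : ℕ, 1 ≤ k ∧ IsVeryAmple E L k

/-- The sections of `iL` separate the points of `U`. -/
def SeparatesPointsOn (i : ℕ) (U : Set M) : Prop :=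
  ∀ p ∈ U, ∀ q ∈ U, p ≠ q → ∃ s ∈ H0 E L i, s p = 0 ∧ s q ≠ 0

/-- The sections of `iL` separate the tangent vectors at the points of `U`. -/
def SeparatesTangentVectorsOn (i : ℕ) (U : Set M) : Prop :=
  ∀ p ∈ U, ∀ τ : TangentSpace 𝓘(ℂ, E) p, τ ≠ 0 →
    ∃ s : H0 E L i, s.1 p = 0 ∧ dSection E L i p τ s ≠ 0

end Bundle

end PolarizedManifold

end

/-! Near a point p where a section σ of L does not vanish, a section s of iL becomes the function
s/σ^i, and these functions add and multiply like the sections. For i ≤ r this is σ^(r-i)s/σ^r, a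
ratio of two sections of rL, so it factors through φ_{|rL|} (`quot_eq_div`). By r-generation every
s/σ^k is a polynomial in such ratios.

Take kL very ample. If φ_{|rL|}(x) tends to φ_{|rL|}(p), then all s/σ^k converge, so φ_{|kL|}(x)
tends to φ_{|kL|}(p) (`IsGenerated.tendsto_phi`) and x tends to p. Hence φ_{|rL|} induces the
topology, and it is injective because M is Hausdorff. Likewise, a tangent vector τ annihilating
every section of rL that vanishes at p annihilates the ratios, and by Leibniz all s/σ^k; then
dφ_{|kL|}(τ) = 0, so τ = 0. -/

namespace PolarizedManifold

open Filter

/-! ### Convergence in the projective space of a dual -/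

section Projectivization

variable {V : Type*} [AddCommGroup V] [Module ℂ V]

/-- A map to `ℙ(V^*)` converges to `[v]` if it eventually lifts to functionals which converge
pointwise to `v`. -/
theorem tendsto_mk_of_forall_tendsto {α : Type*} {F : Filter α} {φ : α → ℙ ℂ (Module.Dual ℂ V)}
    {u : α → Module.Dual ℂ V} {v : Module.Dual ℂ V} (hv : v ≠ 0)
    (hφ : ∀ᶠ x in F, ∃ h : u x ≠ 0, φ x = Projectivization.mk ℂ (u x) h)
    (hu : ∀ s, Tendsto (fun x => u x s) F (𝓝 (v s))) :
    Tendsto φ F (𝓝 (Projectivization.mk ℂ v hv)) := by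
  rw [tendsto_nhds]
  intro O hO hvO
  obtain ⟨W, hW, hWO⟩ := hO
  have hvW : (fun s => v s) ∈ W := by
    have : (⟨v, hv⟩ : {v : Module.Dual ℂ V // v ≠ 0}) ∈
        (fun (v : {v : Module.Dual ℂ V // v ≠ 0}) (s : V) => v.1 s) ⁻¹' W := by
      rw [hWO]; exact hvO
    exact this
  have huW : Tendsto (fun x s => u x s) F (𝓝 (fun s => v s)) := tendsto_pi_nhds.2 hu
  filter_upwards [hφ, huW (hW.mem_nhds hvW)] with x hx hxW
  obtain ⟨h, hx⟩ := hx
  have : (⟨u x, h⟩ : {v : Module.Dual ℂ V // v ≠ 0}) ∈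
      (fun v : {v : Module.Dual ℂ V // v ≠ 0} => Projectivization.mk ℂ v.1 v.2) ⁻¹' O := by
    rw [← hWO]; exact hxW
  rw [Set.mem_preimage, hx]
  exact this

/-- The ratio is invariant under scaling, so the choice of `rep` is immaterial, and the condition is
open on functions `V → ℂ`. -/
theorem isOpen_setOf_rep_ratio_mem (t w : V) {O : Set ℂ} (hO : IsOpen O) :
    IsOpen {P : ℙ ℂ (Module.Dual ℂ V) | P.rep w ≠ 0 ∧ P.rep t / P.rep w ∈ O} := by
  refine ⟨{f : V → ℂ | f w ≠ 0 ∧ f t / f w ∈ O}, ?_, ?_⟩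
  · have hw : IsOpen {f : V → ℂ | f w ≠ 0} := isOpen_ne.preimage (continuous_apply w)
    have hc : ContinuousOn (fun f : V → ℂ => f t / f w) {f : V → ℂ | f w ≠ 0} :=
      (continuous_apply t).continuousOn.div (continuous_apply w).continuousOn fun _ h => h
    exact hc.isOpen_inter_preimage hw hO
  · ext ⟨v, hv⟩
    obtain ⟨a, ha⟩ := Projectivization.exists_smul_eq_mk_rep ℂ v hv
    simp only [Set.mem_preimage, Set.mem_ofPred_eq, ← ha]
    simp [Units.smul_def, mul_div_mul_left]

/-- The ratio of two linear coordinates is continuous on `ℙ(V^*)` where the denominator does not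
vanish. -/
theorem tendsto_div_of_tendsto_mk {α : Type*} {F : Filter α} {u : α → Module.Dual ℂ V}
    (hu : ∀ x, u x ≠ 0) {v : Module.Dual ℂ V} (hv : v ≠ 0)
    (h : Tendsto (fun x => Projectivization.mk ℂ (u x) (hu x)) F (𝓝 (Projectivization.mk ℂ v hv)))
    (t : V) {w : V} (hw : v w ≠ 0) :
    Tendsto (fun x => u x t / u x w) F (𝓝 (v t / v w)) := by
  have key (v : Module.Dual ℂ V) (hv : v ≠ 0) (O : Set ℂ) :
      Projectivization.mk ℂ v hv ∈
        {P : ℙ ℂ (Module.Dual ℂ V) | P.rep w ≠ 0 ∧ P.rep t / P.rep w ∈ O} ↔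
      v w ≠ 0 ∧ v t / v w ∈ O := by
    obtain ⟨a, ha⟩ := Projectivization.exists_smul_eq_mk_rep ℂ v hv
    simp only [Set.mem_ofPred_eq, ← ha]
    simp [Units.smul_def, mul_div_mul_left]
  rw [tendsto_nhds]
  intro O hO hvO
  filter_upwards [h ((isOpen_setOf_rep_ratio_mem t w hO).mem_nhds ((key v hv O).2 ⟨hw, hvO⟩))]
    with x hx
  exact ((key _ (hu x) O).1 hx).2

/-- The ratio of `w` to itself tends to 1, whereas it is `0 / 0 = 0` wherever `u x w` vanishes. -/
theorem eventually_apply_ne_zero_of_tendsto_mk {α : Type*} {F : Filter α} {u : α → Module.Dual ℂ V}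
    (hu : ∀ x, u x ≠ 0) {v : Module.Dual ℂ V} (hv : v ≠ 0)
    (h : Tendsto (fun x => Projectivization.mk ℂ (u x) (hu x)) F (𝓝 (Projectivization.mk ℂ v hv)))
    {w : V} (hw : v w ≠ 0) : ∀ᶠ x in F, u x w ≠ 0 := by
  have h1 := tendsto_div_of_tendsto_mk hu hv h w hw
  rw [div_self hw] at h1
  filter_upwards [h1.eventually_ne one_ne_zero] with x hx hx0
  simp [hx0] at hx

end Projectivization

/-! ### Sections, generation, and quotients by powers of a section of L -/

theorem lift_smul_apply_of_mem_pow {N : Type*} [AddCommGroup N] [Module ℂ N] (c : ℂ)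
    (f : N →ₗ[ℂ] ℂ) {i : ℕ} {a : TensorAlgebra ℂ N}
    (ha : a ∈ LinearMap.range (TensorAlgebra.ι ℂ (M := N)) ^ i) :
    TensorAlgebra.lift ℂ (c • f) a = c ^ i * TensorAlgebra.lift ℂ f a := by
  induction ha using Submodule.pow_induction_on_left' with
  | algebraMap z => simp
  | add x y i _ _ hx hy => rw [map_add, map_add, hx, hy, mul_add]
  | mem_mul m hm i x _ hx =>
    obtain ⟨n, rfl⟩ := hm
    rw [map_mul, map_mul, hx]
    simp only [TensorAlgebra.lift_ι_apply, LinearMap.smul_apply, smul_eq_mul, Nat.succ_eq_add_one]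
    ring

section Bundle

variable {E : Type*} [NormedAddCommGroup E] [NormedSpace ℂ E]
  {M : Type*} [TopologicalSpace M] [ChartedSpace E M]
  {L : M → Type*} [TopologicalSpace (TotalSpace ℂ L)]
  [∀ x, AddCommGroup (L x)] [∀ x, Module ℂ (L x)] [∀ x, TopologicalSpace (L x)]
  [FiberBundle ℂ L] [VectorBundle ℂ ℂ L]

theorem coord_pow (e : Trivialization ℂ (π ℂ L)) [MemTrivializationAtlas e]
    (s : ∀ x, TensorAlgebra ℂ (L x)) (n : ℕ) : coord e (s ^ n) = coord e s ^ n := by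
  funext x; simp [coord]

theorem coord_eq_zero_of_eq_zero (e : Trivialization ℂ (π ℂ L)) [MemTrivializationAtlas e]
    {s : ∀ x, TensorAlgebra ℂ (L x)} {x : M} (h : s x = 0) : coord e s x = 0 := by
  simp [coord, h]

theorem pow_mem_H0 {s : ∀ x, TensorAlgebra ℂ (L x)} (hs : s ∈ H0 E L 1) (n : ℕ) :
    s ^ n ∈ H0 E L n := by
  induction n with
  | zero =>
    refine ⟨fun x => by simp [Submodule.one_le.1 le_rfl], fun e _ => ?_⟩
    rw [coord_pow, pow_zero]
    exact contMDiffOn_const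
  | succ n ih => rw [pow_succ]; exact mul_mem_H0 E L ih hs

/-- `P` must make sense for inhomogeneous sums, since the generated algebra contains them; this is
why `quot` is defined on the whole tensor algebra. -/
theorem IsGenerated.induction {r : ℕ} (hgen : IsGenerated E L r)
    {P : (∀ x, TensorAlgebra ℂ (L x)) → Prop}
    (gen : ∀ i, 1 ≤ i → i ≤ r → ∀ s ∈ H0 E L i, P s) (zero : P 0)
    (add : ∀ s t, P s → P t → P (s + t)) (mul : ∀ s t, P s → P t → P (s * t))
    (smul : ∀ (c : ℂ) s, P s → P (c • s)) {k : ℕ} (hk : 1 ≤ k)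
    {s : ∀ x, TensorAlgebra ℂ (L x)} (hs : s ∈ H0 E L k) : P s := by
  have hmem : s ∈ sectionAlgebra E L :=
    Submodule.mem_iSup_of_mem (p := fun i : {i : ℕ // 1 ≤ i} => H0 E L i) ⟨k, hk⟩ hs
  rw [← hgen] at hmem
  clear hs
  induction hmem using NonUnitalAlgebra.adjoin_induction with
  | mem x hx =>
    simp only [Set.mem_iUnion, Set.mem_Icc] at hx
    obtain ⟨i, ⟨h1, h2⟩, hx⟩ := hx
    exact gen i h1 h2 x hx
  | zero => exact zero
  | add x y _ _ hx hy => exact add x y hx hy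
  | mul x y _ _ hx hy => exact mul x y hx hy
  | smul c x _ hx => exact smul c x hx

/-- A change of trivialization rescales the coordinates of all sections of `iL` at a point by a
common nonzero factor. -/
theorem exists_coord_eq_mul (i : ℕ) (e e' : Trivialization ℂ (π ℂ L)) [MemTrivializationAtlas e]
    [MemTrivializationAtlas e'] {x : M} (hx : x ∈ e.baseSet) (hx' : x ∈ e'.baseSet) :
    ∃ c : ℂ, c ≠ 0 ∧ ∀ s ∈ H0 E L i, coord e s x = c * coord e' s x := by
  set ℓ := e.linearEquivAt ℂ x hx
  set ℓ' := e'.linearEquivAt ℂ x hx'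
  have hle : e.linearMapAt ℂ x = (ℓ : L x →ₗ[ℂ] ℂ) := e.linearMapAt_def_of_mem hx
  have hle' : e'.linearMapAt ℂ x = (ℓ' : L x →ₗ[ℂ] ℂ) := e'.linearMapAt_def_of_mem hx'
  have h : e.linearMapAt ℂ x = ℓ (ℓ'.symm 1) • e'.linearMapAt ℂ x := by
    rw [hle, hle']
    ext v
    have hv : v = ℓ' v • ℓ'.symm 1 := by
      rw [← map_smul, smul_eq_mul, mul_one, ℓ'.symm_apply_apply]
    conv_lhs => rw [hv]
    simp [mul_comm]
  refine ⟨ℓ (ℓ'.symm 1) ^ i, pow_ne_zero _ (by simp), fun s hs => ?_⟩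
  rw [coord, h, lift_smul_apply_of_mem_pow _ _ (hs.1 x), coord]

/-- The quotient `s / σ^i` of a section `s` of `iL` by a power of a section `σ` of `L`, extended
to an algebra homomorphism. It takes the value `0` in positive degrees where `σ` vanishes. -/
noncomputable def quot (σ : ∀ x, TensorAlgebra ℂ (L x)) (e : Trivialization ℂ (π ℂ L))
    [MemTrivializationAtlas e] (s : ∀ x, TensorAlgebra ℂ (L x)) (x : M) : ℂ :=
  TensorAlgebra.lift ℂ ((coord e σ x)⁻¹ • e.linearMapAt ℂ x) (s x)

section Quot

variable (σ : ∀ x, TensorAlgebra ℂ (L x)) (e : Trivialization ℂ (π ℂ L)) [MemTrivializationAtlas e]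

theorem quot_zero : quot σ e 0 = 0 := by funext x; simp [quot]

theorem quot_add (s t : ∀ x, TensorAlgebra ℂ (L x)) :
    quot σ e (s + t) = quot σ e s + quot σ e t := by funext x; simp [quot]

theorem quot_mul (s t : ∀ x, TensorAlgebra ℂ (L x)) :
    quot σ e (s * t) = quot σ e s * quot σ e t := by funext x; simp [quot]

theorem quot_smul (c : ℂ) (s : ∀ x, TensorAlgebra ℂ (L x)) :
    quot σ e (c • s) = c • quot σ e s := by funext x; simp [quot]

theorem quot_eq {i : ℕ} {s : ∀ x, TensorAlgebra ℂ (L x)} (hs : s ∈ H0 E L i) (x : M) :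
    quot σ e s x = (coord e σ x)⁻¹ ^ i * coord e s x :=
  lift_smul_apply_of_mem_pow _ _ (hs.1 x)

variable {σ e}

/-- Multiplying by σ^(r-i) raises the degree to r without changing the quotient. -/
theorem quot_eq_div {i r : ℕ} (hi : i ≤ r) {s : ∀ x, TensorAlgebra ℂ (L x)} (hs : s ∈ H0 E L i)
    {x : M} (hx : coord e σ x ≠ 0) :
    quot σ e s x = coord e (σ ^ (r - i) * s) x / coord e (σ ^ r) x := by
  obtain ⟨j, rfl⟩ := Nat.exists_eq_add_of_le hi
  rw [quot_eq σ e hs, coord_mul, coord_pow, coord_pow, Nat.add_sub_cancel_left, Pi.mul_apply,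
    Pi.pow_apply, Pi.pow_apply, pow_add, inv_pow]
  field_simp

theorem coord_eq_quot_mul {i : ℕ} {s : ∀ x, TensorAlgebra ℂ (L x)} (hs : s ∈ H0 E L i)
    {x : M} (hx : coord e σ x ≠ 0) : coord e s x = quot σ e s x * coord e σ x ^ i := by
  rw [quot_eq σ e hs, inv_pow]
  field_simp

end Quot

theorem exists_coord_ne_zero {i : ℕ} {x : M} (hx : x ∉ baseLocus E L i) :
    ∃ σ ∈ H0 E L i, coord (trivializationAt ℂ L x) σ x ≠ 0 := by
  by_contra! h
  exact hx fun s hs => eq_zero_of_coord_eq_zero _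
    (FiberBundle.mem_baseSet_trivializationAt' x) (hs.1 x) (h s hs)

theorem notMem_baseLocus_of_notMem_baseLocus_one (r : ℕ) {x : M} (hx : x ∉ baseLocus E L 1) :
    x ∉ baseLocus E L r := by
  obtain ⟨σ, hσ, h⟩ := exists_coord_ne_zero hx
  intro hx'
  have := coord_eq_zero_of_eq_zero (trivializationAt ℂ L x) (hx' _ (pow_mem_H0 hσ r))
  rw [coord_pow, Pi.pow_apply] at this
  exact pow_ne_zero r h this

/-! ### The topological embedding -/

/-- Near p all sections are read in the single trivialization at p; this gives a continuous lift
that differs from `evalAt` by a nonzero scalar at each point. -/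
theorem continuous_phi (i : ℕ) : Continuous (phi E L i) := by
  rw [continuous_iff_continuousAt]
  intro p
  set e := trivializationAt ℂ L p.1
  have hp : p.1 ∈ e.baseSet := FiberBundle.mem_baseSet_trivializationAt' p.1
  let u : {x : M // x ∉ baseLocus E L i} → Module.Dual ℂ (H0 E L i) := fun x =>
    { toFun := fun s => coord e s.1 x.1
      map_add' := fun s t => by simp [coord_add]
      map_smul' := fun c s => by simp [coord_smul] }
  refine tendsto_mk_of_forall_tendsto (u := u) (evalAt_ne_zero E L p.2) ?_ fun s => ?_
  · have hmem : ∀ᶠ x : {x : M // x ∉ baseLocus E L i} in 𝓝 p, x.1 ∈ e.baseSet :=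
      continuous_subtype_val.continuousAt (e.open_baseSet.mem_nhds hp)
    filter_upwards [hmem] with x hx
    obtain ⟨c, hc, h⟩ := exists_coord_eq_mul (E := E) i (trivializationAt ℂ L x.1) e
      (FiberBundle.mem_baseSet_trivializationAt' x.1) hx
    have heq : c • u x = evalAt E L i x.1 := by
      ext s
      exact (h s.1 s.2).symm
    have hu : u x ≠ 0 := by
      intro h0
      rw [h0, smul_zero] at heq
      exact evalAt_ne_zero E L x.2 heq.symm
    exact ⟨hu, (Projectivization.mk_eq_mk_iff' ℂ _ _ _ _).2 ⟨c, heq⟩⟩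
  · have hc : ContinuousAt (coord e s.1) p.1 :=
      (s.2.2 e).continuousOn.continuousAt (e.open_baseSet.mem_nhds hp)
    exact hc.tendsto.comp continuous_subtype_val.continuousAt

/-- If `L` is `r`-generated, then along a filter on `M \ Bs |L|` on which `φ_{|rL|}` converges to
`φ_{|rL|}(p)`, the map `φ_{|kL|}` converges to `φ_{|kL|}(p)`. -/
theorem IsGenerated.tendsto_phi {r : ℕ} (hgen : IsGenerated E L r) (hr : 1 ≤ r) {k : ℕ}
    (hk : 1 ≤ k) {α : Type*} {F : Filter α} {x : α → M} {p : M} (hp : p ∉ baseLocus E L 1)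
    (hxr : ∀ a, x a ∉ baseLocus E L r) (hpr : p ∉ baseLocus E L r)
    (hxk : ∀ a, x a ∉ baseLocus E L k) (hpk : p ∉ baseLocus E L k)
    (h : Tendsto (fun a => phi E L r ⟨x a, hxr a⟩) F (𝓝 (phi E L r ⟨p, hpr⟩))) :
    Tendsto (fun a => phi E L k ⟨x a, hxk a⟩) F (𝓝 (phi E L k ⟨p, hpk⟩)) := by
  obtain ⟨σ, hσ, hσp⟩ := exists_coord_ne_zero hp
  let w : H0 E L r := ⟨σ ^ r, pow_mem_H0 hσ r⟩
  have hw (y : M) : evalAt E L r y w = coord (trivializationAt ℂ L y) σ y ^ r := by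
    change coord (trivializationAt ℂ L y) (σ ^ r) y = _
    rw [coord_pow, Pi.pow_apply]
  have hwp : evalAt E L r p w ≠ 0 := by
    rw [hw]; exact pow_ne_zero _ hσp
  -- Nonvanishing of σ^r at p passes to nearby values of φ_{|rL|}; `1 ≤ r` then yields nonvanishing
  -- of σ itself.
  have hne : ∀ᶠ a in F, coord (trivializationAt ℂ L (x a)) σ (x a) ≠ 0 := by
    filter_upwards [eventually_apply_ne_zero_of_tendsto_mk (fun a => evalAt_ne_zero E L (hxr a))
      (evalAt_ne_zero E L hpr) h hwp] with a ha h0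
    rw [hw, h0, zero_pow (by lia)] at ha
    exact ha rfl
  let χ (s : ∀ x, TensorAlgebra ℂ (L x)) (y : M) : ℂ := quot σ (trivializationAt ℂ L y) s y
  have hχ : ∀ s ∈ H0 E L k, Tendsto (fun a => χ s (x a)) F (𝓝 (χ s p)) := by
    intro s hs
    refine hgen.induction (P := fun s => Tendsto (fun a => χ s (x a)) F (𝓝 (χ s p)))
      ?_ ?_ ?_ ?_ ?_ hk hs
    · intro i _ hi s hs
      let t : H0 E L r := ⟨σ ^ (r - i) * s, by
        have := mul_mem_H0 E L (pow_mem_H0 hσ (r - i)) hs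
        rwa [Nat.sub_add_cancel hi] at this⟩
      have ht {y : M} (hy : coord (trivializationAt ℂ L y) σ y ≠ 0) :
          χ s y = evalAt E L r y t / evalAt E L r y w := quot_eq_div hi hs hy
      rw [ht hσp]
      refine (tendsto_div_of_tendsto_mk (fun a => evalAt_ne_zero E L (hxr a))
        (evalAt_ne_zero E L hpr) h t hwp).congr' ?_
      filter_upwards [hne] with a ha using (ht ha).symm
    · simp only [χ, quot_zero]
      exact tendsto_const_nhds
    · intro s t hs ht
      simp only [χ, quot_add]
      exact hs.add ht
    · intro s t hs ht
      simp only [χ, quot_mul]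
      exact hs.mul ht
    · intro c s hs
      simp only [χ, quot_smul]
      exact hs.const_smul c
  -- Normalizing the evaluation by σ^k turns its values into the quotients `χ`, so it is a
  -- convergent lift of φ_{|kL|}.
  let v (y : M) : Module.Dual ℂ (H0 E L k) :=
    (coord (trivializationAt ℂ L y) σ y)⁻¹ ^ k • evalAt E L k y
  have hv (y : M) (s : H0 E L k) : v y s = χ s.1 y :=
    (quot_eq σ (trivializationAt ℂ L y) s.2 y).symm
  have hv0 {y : M} (hy : coord (trivializationAt ℂ L y) σ y ≠ 0) (hyk : y ∉ baseLocus E L k) :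
      ∃ h : v y ≠ 0, phi E L k ⟨y, hyk⟩ = Projectivization.mk ℂ (v y) h := by
    have hc := pow_ne_zero k (inv_ne_zero hy)
    refine ⟨smul_ne_zero hc (evalAt_ne_zero E L hyk), Eq.symm ?_⟩
    exact (Projectivization.mk_eq_mk_iff' ℂ _ _ _ _).2 ⟨_, rfl⟩
  obtain ⟨hvp, hvp'⟩ := hv0 hσp hpk
  rw [hvp']
  refine tendsto_mk_of_forall_tendsto (u := fun a => v (x a)) hvp ?_ fun s => ?_
  · filter_upwards [hne] with a ha using hv0 ha (hxk a)
  · simp only [hv]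
    exact hχ s.1 s.2

theorem IsGenerated.isInducing_phi {r : ℕ} (hgen : IsGenerated E L r) (hr : 1 ≤ r)
    (hample : IsAmple E L) (hU : ∀ x ∈ (baseLocus E L 1)ᶜ, x ∉ baseLocus E L r) :
    IsInducing (fun x : ↥(baseLocus E L 1)ᶜ => phi E L r ⟨x.1, hU x.1 x.2⟩) := by
  obtain ⟨k, hk, hUk, hemb, -⟩ := hample
  rw [isInducing_iff_nhds]
  intro p
  refine le_antisymm ?_ ?_
  · exact tendsto_iff_comap.1 (((continuous_phi r).comp
      (continuous_subtype_val.subtype_mk fun x => hU x.1 x.2)).tendsto p)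
  · rw [nhds_subtype_eq_comap, ← tendsto_iff_comap]
    -- The filter is the pullback of the neighbourhoods of φ_{|rL|}(p), along which φ_{|rL|}
    -- converges tautologically.
    have h := hgen.tendsto_phi hr hk (x := fun x : ↥(baseLocus E L 1)ᶜ => x.1) p.2
      (fun x => hU x.1 x.2) (hU p.1 p.2) (fun x => hUk x.1 trivial) (hUk p.1 trivial) tendsto_comap
    have h' : Tendsto (fun x : ↥(baseLocus E L 1)ᶜ => (⟨x.1, trivial⟩ : (Set.univ : Set M)))
        (comap (fun x : ↥(baseLocus E L 1)ᶜ => phi E L r ⟨x.1, hU x.1 x.2⟩)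
          (𝓝 (phi E L r ⟨p.1, hU p.1 p.2⟩))) (𝓝 ⟨p.1, trivial⟩) :=
      hemb.isInducing.tendsto_nhds_iff.2 h
    exact (continuous_subtype_val.tendsto (⟨p.1, trivial⟩ : (Set.univ : Set M))).comp h'

/-- If every section vanishing at p vanishes at q, the kernels of the two evaluations are nested, so
the evaluations are proportional. -/
theorem separatesPointsOn_of_injective {i : ℕ} {U : Set M} (hU : ∀ x ∈ U, x ∉ baseLocus E L i)
    (hinj : Function.Injective (fun x : U => phi E L i ⟨x.1, hU x.1 x.2⟩)) :
    SeparatesPointsOn E L i U := by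
  intro p hp q hq hpq
  by_contra! h
  have hker : LinearMap.ker (evalAt E L i p) ≤ LinearMap.ker (evalAt E L i q) := by
    intro s hs
    exact coord_eq_zero_of_eq_zero _ (h s.1 s.2 (eq_zero_of_coord_eq_zero _
      (FiberBundle.mem_baseSet_trivializationAt' p) (s.2.1 p) hs))
  have hmem : evalAt E L i q ∈ Submodule.span ℂ (Set.range fun _ : Unit => evalAt E L i p) :=
    mem_span_of_iInf_ker_le_ker (by simpa using hker)
  rw [Set.range_const, Submodule.mem_span_singleton] at hmem
  obtain ⟨c, hc⟩ := hmem
  have heq : phi E L i ⟨q, hU q hq⟩ = phi E L i ⟨p, hU p hp⟩ :=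
    (Projectivization.mk_eq_mk_iff' ℂ _ _ _ _).2 ⟨c, hc⟩
  exact hpq (Subtype.ext_iff.1 (@hinj ⟨q, hq⟩ ⟨p, hp⟩ heq)).symm

/-! ### The differential -/

section Tangent

/-- The directional derivative of a complex-valued function on `M`. -/
noncomputable def dirDeriv (p : M) (τ : TangentSpace 𝓘(ℂ, E) p) (f : M → ℂ) : ℂ :=
  mfderiv 𝓘(ℂ, E) 𝓘(ℂ, ℂ) f p τ

variable {p : M} {τ : TangentSpace 𝓘(ℂ, E) p} {f g : M → ℂ}

theorem dirDeriv_mul (hf : MDifferentiableAt 𝓘(ℂ, E) 𝓘(ℂ, ℂ) f p)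
    (hg : MDifferentiableAt 𝓘(ℂ, E) 𝓘(ℂ, ℂ) g p) :
    dirDeriv p τ (f * g) = f p * dirDeriv p τ g + g p * dirDeriv p τ f := by
  have h := (hf.hasMFDerivAt.mul hg.hasMFDerivAt).mfderiv
  exact congrArg (fun A => A τ) h

theorem dirDeriv_add (hf : MDifferentiableAt 𝓘(ℂ, E) 𝓘(ℂ, ℂ) f p)
    (hg : MDifferentiableAt 𝓘(ℂ, E) 𝓘(ℂ, ℂ) g p) :
    dirDeriv p τ (f + g) = dirDeriv p τ f + dirDeriv p τ g :=
  congrArg (fun A => A τ) (mfderiv_add hf hg)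

theorem dirDeriv_smul (c : ℂ) (hf : MDifferentiableAt 𝓘(ℂ, E) 𝓘(ℂ, ℂ) f p) :
    dirDeriv p τ (c • f) = c * dirDeriv p τ f :=
  congrArg (fun A => A τ) (const_smul_mfderiv hf c)

theorem dirDeriv_zero : dirDeriv p τ 0 = 0 :=
  congrArg (fun A => A τ) (mfderiv_const (I := 𝓘(ℂ, E)) (I' := 𝓘(ℂ, ℂ)) (c := (0 : ℂ)) (x := p))

theorem dirDeriv_congr (h : f =ᶠ[𝓝 p] g) : dirDeriv p τ f = dirDeriv p τ g := by
  simp only [dirDeriv]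
  rw [h.mfderiv_eq]
  rfl

theorem IsGenerated.separatesTangentVectorsOn {r : ℕ} (hgen : IsGenerated E L r)
    (hample : IsAmple E L) : SeparatesTangentVectorsOn E L r (baseLocus E L 1)ᶜ := by
  obtain ⟨k, hk, -, -, hinj⟩ := hample
  intro p hp τ hτ
  by_contra! h
  obtain ⟨σ, hσ, hσp⟩ := exists_coord_ne_zero hp
  set e := trivializationAt ℂ L p
  have hpe : p ∈ e.baseSet := FiberBundle.mem_baseSet_trivializationAt' p
  have hd {i : ℕ} {s : ∀ x, TensorAlgebra ℂ (L x)} (hs : s ∈ H0 E L i) :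
      MDifferentiableAt 𝓘(ℂ, E) 𝓘(ℂ, ℂ) (coord e s) p :=
    mdifferentiableAt_coord (⟨s, hs⟩ : H0 E L i) p
  have hne : ∀ᶠ y in 𝓝 p, coord e σ y ≠ 0 := (hd hσ).continuousAt.eventually_ne hσp
  have hdq {i : ℕ} {s : ∀ x, TensorAlgebra ℂ (L x)} (hs : s ∈ H0 E L i) :
      MDifferentiableAt 𝓘(ℂ, E) 𝓘(ℂ, ℂ) (quot σ e s) p := by
    have : quot σ e s = (coord e σ)⁻¹ ^ i * coord e s := funext (quot_eq σ e hs)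
    rw [this]
    exact (((hd hσ).inv hσp).pow i).mul (hd hs)
  have hcoord {i : ℕ} {s : ∀ x, TensorAlgebra ℂ (L x)} (hs : s ∈ H0 E L i) :
      dirDeriv p τ (coord e s) = quot σ e s p * dirDeriv p τ (coord e σ ^ i) +
        coord e σ p ^ i * dirDeriv p τ (quot σ e s) := by
    refine Eq.trans (dirDeriv_congr ?_) (dirDeriv_mul (hdq hs) ((hd hσ).pow i))
    filter_upwards [hne] with y hy using coord_eq_quot_mul hs hy
  have hr {s : ∀ x, TensorAlgebra ℂ (L x)} (hs : s ∈ H0 E L r) :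
      dirDeriv p τ (quot σ e s) = 0 := by
    have hσr := pow_mem_H0 hσ r
    have hc := (H0 E L r).smul_mem (-quot σ e s p) hσr
    have hw := (H0 E L r).add_mem hs hc
    -- Subtracting the right multiple of σ^r makes the section vanish at p; its derivative is then
    -- σ(p)^r times that of s/σ^r.
    have h1 : dirDeriv p τ (coord e (s + (-quot σ e s p) • σ ^ r)) = 0 := by
      refine h ⟨_, hw⟩ (eq_zero_of_coord_eq_zero e hpe (hw.1 p) ?_)
      rw [coord_add, coord_smul, coord_pow, Pi.add_apply,
        coord_eq_quot_mul (e := e) hs hσp]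
      simp
    rw [coord_add, dirDeriv_add (hd hs) (hd hc), coord_smul, dirDeriv_smul _ (hd hσr), coord_pow,
      hcoord hs] at h1
    have h2 : coord e σ p ^ r * dirDeriv p τ (quot σ e s) = 0 := by linear_combination h1
    exact (mul_eq_zero.1 h2).resolve_left (pow_ne_zero _ hσp)
  have hall {s : ∀ x, TensorAlgebra ℂ (L x)} (hs : s ∈ H0 E L k) :
      dirDeriv p τ (quot σ e s) = 0 := by
    -- Differentiability is carried along because the sum and product rules need it for sums of
    -- mixed degree too.
    refine (hgen.induction (P := fun s => MDifferentiableAt 𝓘(ℂ, E) 𝓘(ℂ, ℂ) (quot σ e s) p ∧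
      dirDeriv p τ (quot σ e s) = 0) ?_ ?_ ?_ ?_ ?_ hk hs).2
    · intro i _ hi s hs
      refine ⟨hdq hs, ?_⟩
      have ht : σ ^ (r - i) * s ∈ H0 E L r := by
        have := mul_mem_H0 E L (pow_mem_H0 hσ (r - i)) hs
        rwa [Nat.sub_add_cancel hi] at this
      rw [← hr ht]
      refine dirDeriv_congr ?_
      filter_upwards [hne] with y hy
      rw [quot_eq_div hi hs hy, quot_eq_div le_rfl ht hy, Nat.sub_self, pow_zero, one_mul]
    · rw [quot_zero]
      exact ⟨mdifferentiableAt_const, dirDeriv_zero⟩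
    · rintro s t ⟨hs, hs'⟩ ⟨ht, ht'⟩
      rw [quot_add, dirDeriv_add hs ht, hs', ht', add_zero]
      exact ⟨hs.add ht, rfl⟩
    · rintro s t ⟨hs, hs'⟩ ⟨ht, ht'⟩
      rw [quot_mul, dirDeriv_mul hs ht, hs', ht']
      exact ⟨hs.mul ht, by simp⟩
    · rintro c s ⟨hs, hs'⟩
      rw [quot_smul, dirDeriv_smul c hs, hs', mul_zero]
      exact ⟨hs.const_smul c, rfl⟩
  refine hτ (hinj p trivial (a₁ := τ) (a₂ := 0) ?_)
  rw [map_zero]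
  -- As d(s/σ^k)(τ) = 0, ds(τ) = (s/σ^k)(p) · d(σ^k)(τ): the factor multiplying s(p) is the same for
  -- all s.
  refine (Submodule.Quotient.mk_eq_zero _).2 (Submodule.mem_span_singleton.2
    ⟨(coord e σ p)⁻¹ ^ k * dirDeriv p τ (coord e σ ^ k), ?_⟩)
  ext s
  change _ * coord e s.1 p = dirDeriv p τ (coord e s.1)
  rw [hcoord s.2, hall s.2, quot_eq σ e s.2]
  ring

/-- A vector in the kernel satisfies ds(τ) = c · s(p) for all s with one constant c, so ds(τ) = 0
whenever s(p) = 0. -/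
theorem SeparatesTangentVectorsOn.injective_dPhi {i : ℕ} {U : Set M}
    (h : SeparatesTangentVectorsOn E L i U) {p : M} (hp : p ∈ U) :
    Function.Injective (dPhi E L i p) := by
  rw [← LinearMap.ker_eq_bot, LinearMap.ker_eq_bot']
  intro τ hτ
  by_contra hτ0
  obtain ⟨s, hs, hds⟩ := h p hp τ hτ0
  obtain ⟨c, hc⟩ := Submodule.mem_span_singleton.1 ((Submodule.Quotient.mk_eq_zero _).1 hτ)
  refine hds ?_
  have h1 : dSection E L i p τ s = c * evalAt E L i p s := (LinearMap.congr_fun hc s).symm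
  have h2 : evalAt E L i p s = 0 := coord_eq_zero_of_eq_zero _ hs
  rw [h1, h2, mul_zero]

end Tangent

end Bundle

end PolarizedManifold

theorem mainTheorem1
    {E : Type*} [NormedAddCommGroup E] [NormedSpace ℂ E] [FiniteDimensional ℂ E]
    {M : Type*} [TopologicalSpace M] [T2Space M] [CompactSpace M]
    [ChartedSpace E M] [IsManifold 𝓘(ℂ, E) ω M]
    (L : M → Type*) [TopologicalSpace (TotalSpace ℂ L)]
    [∀ x, AddCommGroup (L x)] [∀ x, Module ℂ (L x)] [∀ x, TopologicalSpace (L x)]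
    [FiberBundle ℂ L] [VectorBundle ℂ ℂ L] [ContMDiffVectorBundle ω ℂ L 𝓘(ℂ, E)]
    (hample : PolarizedManifold.IsAmple E L)
    (heff : PolarizedManifold.IsEffective E L)
    (r : ℕ) (hr : 1 ≤ r) (hgen : PolarizedManifold.IsGenerated E L r) :
    PolarizedManifold.IsEmbeddingOn E L r (PolarizedManifold.baseLocus E L 1)ᶜ ∧
    PolarizedManifold.SeparatesPointsOn E L r (PolarizedManifold.baseLocus E L 1)ᶜ ∧
    PolarizedManifold.SeparatesTangentVectorsOn E L r (PolarizedManifold.baseLocus E L 1)ᶜ := by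
  have hU : ∀ x ∈ (PolarizedManifold.baseLocus E L 1)ᶜ, x ∉ PolarizedManifold.baseLocus E L r :=
    fun x hx => PolarizedManifold.notMem_baseLocus_of_notMem_baseLocus_one r hx
  have hind := hgen.isInducing_phi hr hample hU
  have htan := hgen.separatesTangentVectorsOn hample
  exact ⟨⟨hU, ⟨hind, hind.injective⟩, fun x hx => htan.injective_dPhi hx⟩,
    PolarizedManifold.separatesPointsOn_of_injective hU hind.injective, htan⟩
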